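/- Throughout, $n,m$ are positive integers, $p$ is a real number with $1\le p<n$, $Q\subset\mathbb{R}^m$ is a convex body (compact, convex, with nonempty interior) containing the origin, $K\subset\mathbb{R}^n$ is compact, and $h_Q(x)=\max_{y\in Q}x\cdot y$. Let $C_c^\infty$ be the space of smooth compactly supported functions $f:\mathbb{R}^n\to\mathbb{R}$. For $f$ with weak gradient $\nabla f$ put $\|f\|_{1,p}=\|f\|_p+\|\nabla f\|_p$, and let $W^{1,p}$ be the space of $f\in L_p(\mathbb{R}^n)$ with weak gradient in $L_p$. The Sobolev $p$-capacity of $E\subset\mathbb{R}^n$ is the infimum of $\|w\|_p^p+\|\nabla w\|_p^p$ over all $w\in W^{1,p}$ with $w\ge1$ almost everywhere in an open set containing $E$. A function $f:\mathbb{R}^n\to\mathbb{R}$ is $p$-quasicontinuous if for every $\varepsilon>0$ there is an open set $G$ of Sobolev $p$-capacity less than $\varepsilon$ such that $f|_{\mathbb{R}^n\setminus G}$ is continuous. Let $W_0^{1,p}$ be the closure of $C_c^\infty$ in $W^{1,p}$ for $\|\cdot\|_{1,p}$, where, as usual for pointwise conditions on Sobolev functions, its elements are represented by $p$-quasicontinuous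 functions, defined at every point. Define $$\mathscr{A}(K)=\{f\in W_0^{1,p}: f\ge \mathbf 1_K \text{ on } \mathbb{R}^n\},\qquad \mathscr{B}(K)=\{f\in W_0^{1,p}: f\ge1\text{ on }K\},$$ $$\mathscr{D}(K)=\{f\in W_0^{1,p}: 0\le f\le1\text{ on }\mathbb{R}^n,\ f=1\text{ in a neighborhood of }K\}.$$ For $f\in W_0^{1,p}$ put $$\mathcal{E}(f)=\Big(\int_{S^{nm-1}}\big\|h_Q\big((\nabla f)^{\mathrm T}u\big)\big\|_p^{-nm}\,du\Big)^{-\frac{p}{nm}}\in[0,\infty],$$ where $S^{nm-1}$ is the unit sphere of the space of real $n\times m$ matrices with the inner product $\mathrm{tr}(x^{\mathrm T}y)$, $du$ is its surface measure, $0^{-a}=\infty$ and $\infty^{-a}=0$ for $a>0$. The $m$th order $p$-affine capacity of $K$ is $C_{p,Q}(K)=\inf_{f\in\mathscr{A}(K)}\mathcal{E}(f)$. **Theorem.** One has $$C_{p,Q}(K)=\inf_{f\in\mathscr{B}(K)}\mathcal{E}(f)=\inf_{f\in\mathscr{D}(K)}\mathcal{E}(f),$$ and moreover $$C_{p,Q}(K)=\inf_{f\in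 C_c^\infty\cap\mathscr{A}(K)}\mathcal{E}(f)=\inf_{f\in C_c^\infty\cap\mathscr{B}(K)}\mathcal{E}(f)=\inf_{f\in C_c^\infty\cap\mathscr{D}(K)}\mathcal{E}(f).$$ -/

import Mathlib

open MeasureTheory Set Filter Topology
open scoped ENNReal ContDiff

noncomputable section

namespace AffineCapacity

/-- `C_c^∞(ℝⁿ)`: smooth, compactly supported real functions. -/
def testFunctions (n : ℕ) : Set (EuclideanSpace ℝ (Fin n) → ℝ) :=
  {φ | ContDiff ℝ ∞ φ ∧ HasCompactSupport φ}

/-- `g` is a weak gradient of `f`: both are locally integrable, and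
`∫ f ∂ᵢφ = - ∫ gᵢ φ` for all test functions `φ` and all `i`. -/
def HasWeakGradient {n : ℕ} (f : EuclideanSpace ℝ (Fin n) → ℝ)
    (g : EuclideanSpace ℝ (Fin n) → EuclideanSpace ℝ (Fin n)) : Prop :=
  LocallyIntegrable f volume ∧ LocallyIntegrable g volume ∧
    ∀ φ ∈ testFunctions n, ∀ i : Fin n,
      ∫ x, f x * fderiv ℝ φ x (EuclideanSpace.single i 1) = - ∫ x, g x i * φ x

open Classical in
/-- The weak gradient `∇f` (determined up to a null set when it exists; `0` if there is none). -/
def weakGrad {n : ℕ} (f : EuclideanSpace ℝ (Fin n) → ℝ) :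
    EuclideanSpace ℝ (Fin n) → EuclideanSpace ℝ (Fin n) :=
  if h : ∃ g, HasWeakGradient f g then h.choose else 0

/-- `f ∈ W^{1,p}(ℝⁿ)`: `f ∈ L_p`, and `f` has a weak gradient in `L_p`. -/
def MemW {n : ℕ} (p : ℝ) (f : EuclideanSpace ℝ (Fin n) → ℝ) : Prop :=
  MemLp f (ENNReal.ofReal p) volume ∧
    ∃ g, HasWeakGradient f g ∧ MemLp g (ENNReal.ofReal p) volume

/-- The norm `‖f‖_{1,p} = ‖f‖_p + ‖∇f‖_p`. -/
def sobolevNorm {n : ℕ} (p : ℝ) (f : EuclideanSpace ℝ (Fin n) → ℝ) : ℝ≥0∞ :=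
  eLpNorm f (ENNReal.ofReal p) volume + eLpNorm (weakGrad f) (ENNReal.ofReal p) volume

/-- `f ∈ W_0^{1,p}(ℝⁿ)`, the closure of `C_c^∞` in `W^{1,p}` for `‖·‖_{1,p}`. -/
def MemW0 {n : ℕ} (p : ℝ) (f : EuclideanSpace ℝ (Fin n) → ℝ) : Prop :=
  MemW p f ∧ ∀ ε : ℝ≥0∞, 0 < ε → ∃ φ ∈ testFunctions n, sobolevNorm p (f - φ) < ε

/-- The Sobolev `p`-capacity of a set `E`: the infimum of `∫ |w|^p + ∫ |∇w|^p` over the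
`w ∈ W^{1,p}` with `w ≥ 1` almost everywhere in an open set that contains `E`. -/
def sobolevCapacity {n : ℕ} (p : ℝ) (E : Set (EuclideanSpace ℝ (Fin n))) : ℝ≥0∞ :=
  sInf {c : ℝ≥0∞ | ∃ w : EuclideanSpace ℝ (Fin n) → ℝ, MemW p w ∧
    (∃ U, IsOpen U ∧ E ⊆ U ∧ ∀ᵐ x ∂volume, x ∈ U → 1 ≤ w x) ∧
    c = eLpNorm w (ENNReal.ofReal p) volume ^ p +
      eLpNorm (weakGrad w) (ENNReal.ofReal p) volume ^ p}

/-- `f` is `p`-quasicontinuous: it becomes continuous after removing open sets of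
arbitrarily small Sobolev `p`-capacity. -/
def QuasiContinuous {n : ℕ} (p : ℝ) (f : EuclideanSpace ℝ (Fin n) → ℝ) : Prop :=
  ∀ ε : ℝ≥0∞, 0 < ε → ∃ G, IsOpen G ∧ sobolevCapacity p G < ε ∧ ContinuousOn f Gᶜ

/-- The Sobolev space `W_0^{1,p}(ℝⁿ)` as a set of functions defined at every point: each class
of functions equal almost everywhere is represented by its `p`-quasicontinuous members
(any two of them agree outside a set of Sobolev `p`-capacity zero). Without such
a choice, pointwise conditions on sets of measure zero would be meaningless. -/
def W0 (n : ℕ) (p : ℝ) : Set (EuclideanSpace ℝ (Fin n) → ℝ) :=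
  {f | MemW0 p f ∧ QuasiContinuous p f}

/-- `𝒜(K)`: the `f ∈ W_0^{1,p}` with `f ≥ 1_K`. -/
def classA {n : ℕ} (p : ℝ) (K : Set (EuclideanSpace ℝ (Fin n))) :
    Set (EuclideanSpace ℝ (Fin n) → ℝ) :=
  {f | f ∈ W0 n p ∧ ∀ x, K.indicator (fun _ => (1 : ℝ)) x ≤ f x}

/-- `ℬ(K)`: the `f ∈ W_0^{1,p}` with `f ≥ 1` on `K`. -/
def classB {n : ℕ} (p : ℝ) (K : Set (EuclideanSpace ℝ (Fin n))) :
    Set (EuclideanSpace ℝ (Fin n) → ℝ) :=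
  {f | f ∈ W0 n p ∧ ∀ x ∈ K, 1 ≤ f x}

/-- `𝒟(K)`: the `f ∈ W_0^{1,p}` with `0 ≤ f ≤ 1`, and `f = 1` in a neighbourhood of `K`. -/
def classD {n : ℕ} (p : ℝ) (K : Set (EuclideanSpace ℝ (Fin n))) :
    Set (EuclideanSpace ℝ (Fin n) → ℝ) :=
  {f | f ∈ W0 n p ∧ (∀ x, 0 ≤ f x ∧ f x ≤ 1) ∧
    ∃ U, IsOpen U ∧ K ⊆ U ∧ ∀ x ∈ U, f x = 1}

/-- The support function `h_Q(x) = max {x · y : y ∈ Q}`. -/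
def supportFn {m : ℕ} (Q : Set (EuclideanSpace ℝ (Fin m))) (x : EuclideanSpace ℝ (Fin m)) : ℝ :=
  sSup ((fun y => inner ℝ x y) '' Q)

/-- The row vector `vᵀ u` for a column `v` of length `n` and an `n × m` matrix `u`. The space of
`n × m` matrices with its trace inner product is `EuclideanSpace ℝ (Fin n × Fin m)`. -/
def rowMul {n m : ℕ} (v : EuclideanSpace ℝ (Fin n)) (u : EuclideanSpace ℝ (Fin n × Fin m)) :
    EuclideanSpace ℝ (Fin m) :=
  WithLp.toLp 2 (Matrix.vecMul v.ofLp (Matrix.of fun i j => u (i, j)))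

/-- `(∫_{S^{nm-1}} ‖h_Q(∇_u f)‖_p^{-nm} du)^{-p/(nm)}` with `∇_u f = (∇f)ᵀ u`, as an element of
`[0, ∞]` (with `0^{-a} = ∞` and `∞^{-a} = 0` for `a > 0`); `du` is the surface measure. -/
def energy {n m : ℕ} (p : ℝ) (Q : Set (EuclideanSpace ℝ (Fin m)))
    (f : EuclideanSpace ℝ (Fin n) → ℝ) : ℝ≥0∞ :=
  (∫⁻ u : Metric.sphere (0 : EuclideanSpace ℝ (Fin n × Fin m)) 1,
      eLpNorm (fun x => supportFn Q (rowMul (weakGrad f x) (u : EuclideanSpace ℝ (Fin n × Fin m))))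
        (ENNReal.ofReal p) volume ^ (-((n : ℝ) * (m : ℝ)))
      ∂(volume : Measure (EuclideanSpace ℝ (Fin n × Fin m))).toSphere)
    ^ (-(p / ((n : ℝ) * (m : ℝ))))

/-- The `m`-th order `p`-affine capacity `C_{p,Q}(K)`. -/
def capacity {n m : ℕ} (p : ℝ) (Q : Set (EuclideanSpace ℝ (Fin m)))
    (K : Set (EuclideanSpace ℝ (Fin n))) : ℝ≥0∞ :=
  ⨅ f ∈ classA p K, energy p Q f

end AffineCapacity

end

noncomputable section

namespace AffineCapacity

/-- The Euclidean space `ℝⁿ`. -/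
local notation "𝔼" n => EuclideanSpace ℝ (Fin n)

section weakGradient

variable {n : ℕ} {f f₁ f₂ : (𝔼 n) → ℝ} {g g₁ g₂ : (𝔼 n) → 𝔼 n}

theorem locallyIntegrable_coord (hg : LocallyIntegrable g volume) (i : Fin n) :
    LocallyIntegrable (fun x => g x i) volume := by
  intro x
  obtain ⟨s, hs, h⟩ := hg x
  exact ⟨s, hs, (EuclideanSpace.proj (𝕜 := ℝ) i).integrable_comp h⟩

theorem HasWeakGradient.unique (h₁ : HasWeakGradient f g₁) (h₂ : HasWeakGradient f g₂) :
    g₁ =ᵐ[volume] g₂ := by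
  have key : ∀ i : Fin n, ∀ᵐ x, g₁ x i - g₂ x i = 0 := by
    intro i
    have hl₁ := locallyIntegrable_coord h₁.2.1 i
    have hl₂ := locallyIntegrable_coord h₂.2.1 i
    refine ae_eq_zero_of_integral_contDiff_smul_eq_zero (hl₁.sub hl₂) fun φ hφ hc => ?_
    have e₁ := h₁.2.2 φ ⟨hφ, hc⟩ i
    have e₂ := h₂.2.2 φ ⟨hφ, hc⟩ i
    have i₁ : Integrable (fun x => φ x • g₁ x i) :=
      hl₁.integrable_smul_left_of_hasCompactSupport hφ.continuous hc
    have i₂ : Integrable (fun x => φ x • g₂ x i) :=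
      hl₂.integrable_smul_left_of_hasCompactSupport hφ.continuous hc
    simp only [smul_sub]
    rw [integral_sub i₁ i₂]
    simp only [smul_eq_mul, mul_comm (φ _)]
    linarith
  filter_upwards [ae_all_iff.2 key] with x hx
  ext i
  exact sub_eq_zero.1 (hx i)

theorem HasWeakGradient.weakGrad_ae_eq (h : HasWeakGradient f g) :
    weakGrad f =ᵐ[volume] g := by
  have hex : ∃ g, HasWeakGradient f g := ⟨g, h⟩
  have : weakGrad f = hex.choose := by simp only [weakGrad, dif_pos hex]
  rw [this]
  exact hex.choose_spec.unique h

theorem HasWeakGradient.congr (h : HasWeakGradient f₁ g₁) (hf : f₁ =ᵐ[volume] f₂)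
    (hg : g₁ =ᵐ[volume] g₂) : HasWeakGradient f₂ g₂ := by
  refine ⟨h.1.congr hf, h.2.1.congr hg, fun φ hφ i => ?_⟩
  rw [← integral_congr_ae (f := fun x => f₁ x * fderiv ℝ φ x (EuclideanSpace.single i 1)),
    h.2.2 φ hφ i, integral_congr_ae]
  · filter_upwards [hg] with x hx
    rw [hx]
  · filter_upwards [hf] with x hx
    rw [hx]

theorem HasWeakGradient.weakGrad (h : HasWeakGradient f g) : HasWeakGradient f (weakGrad f) :=
  h.congr .rfl h.weakGrad_ae_eq.symm

theorem HasWeakGradient.add (h₁ : HasWeakGradient f₁ g₁) (h₂ : HasWeakGradient f₂ g₂) :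
    HasWeakGradient (f₁ + f₂) (g₁ + g₂) := by
  refine ⟨h₁.1.add h₂.1, h₁.2.1.add h₂.2.1, fun φ hφ i => ?_⟩
  have hd : Continuous fun x => fderiv ℝ φ x (EuclideanSpace.single i 1) :=
    (hφ.1.continuous_fderiv (by simp)).clm_apply continuous_const
  have hdc : HasCompactSupport fun x => fderiv ℝ φ x (EuclideanSpace.single i 1) :=
    hφ.2.fderiv_apply ℝ _
  have i₁ := h₁.1.integrable_smul_right_of_hasCompactSupport hd hdc
  have i₂ := h₂.1.integrable_smul_right_of_hasCompactSupport hd hdc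
  have j₁ := (locallyIntegrable_coord h₁.2.1 i).integrable_smul_right_of_hasCompactSupport
    hφ.1.continuous hφ.2
  have j₂ := (locallyIntegrable_coord h₂.2.1 i).integrable_smul_right_of_hasCompactSupport
    hφ.1.continuous hφ.2
  simp only [smul_eq_mul] at i₁ i₂ j₁ j₂
  simp only [Pi.add_apply, PiLp.add_apply, add_mul]
  rw [integral_add i₁ i₂, integral_add j₁ j₂, h₁.2.2 φ hφ i, h₂.2.2 φ hφ i]
  ring

theorem gradient_apply (f : (𝔼 n) → ℝ) (x : 𝔼 n) (i : Fin n) :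
    gradient f x i = fderiv ℝ f x (EuclideanSpace.single i 1) := by
  rw [gradient, ← InnerProductSpace.toDual_symm_apply, EuclideanSpace.inner_single_right]
  simp

theorem continuous_gradient (hf : ContDiff ℝ 1 f) : Continuous (gradient f) :=
  (InnerProductSpace.toDual ℝ (𝔼 n)).symm.continuous.comp (hf.continuous_fderiv (by simp))

theorem hasWeakGradient_gradient (hf : ContDiff ℝ 1 f) : HasWeakGradient f (gradient f) := by
  refine ⟨hf.continuous.locallyIntegrable, (continuous_gradient hf).locallyIntegrable,
    fun φ hφ i => ?_⟩
  have hd : Continuous fun x => fderiv ℝ φ x (EuclideanSpace.single i 1) :=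
    (hφ.1.continuous_fderiv (by simp)).clm_apply continuous_const
  have hfd : Continuous fun x => fderiv ℝ f x (EuclideanSpace.single i 1) :=
    (hf.continuous_fderiv (by simp)).clm_apply continuous_const
  simp only [gradient_apply]
  refine integral_mul_fderiv_eq_neg_fderiv_mul_of_integrable ?_ ?_ ?_
    (fun x _ => hf.differentiable (by simp) x) (fun x _ => hφ.1.differentiable (by simp) x)
  · exact (hfd.mul hφ.1.continuous).integrable_of_hasCompactSupport hφ.2.mul_left
  · exact (hf.continuous.mul hd).integrable_of_hasCompactSupport (hφ.2.fderiv_apply ℝ _).mul_left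
  · exact (hf.continuous.mul hφ.1.continuous).integrable_of_hasCompactSupport hφ.2.mul_left

/-- The convolution of `g` with a normalized smooth bump function. -/
def mollify {F : Type*} [NormedAddCommGroup F] [NormedSpace ℝ F]
    (φ : ContDiffBump (0 : 𝔼 n)) (g : (𝔼 n) → F) : (𝔼 n) → F :=
  convolution (φ.normed volume) g (ContinuousLinearMap.lsmul ℝ ℝ) volume

section mollify

variable {F : Type*} [NormedAddCommGroup F] [NormedSpace ℝ F] (φ : ContDiffBump (0 : 𝔼 n))

theorem mollify_apply (g : (𝔼 n) → F) (x : 𝔼 n) :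
    mollify φ g x = ∫ t, φ.normed volume t • g (x - t) := rfl

theorem mollify_apply_swap (g : (𝔼 n) → F) (x : 𝔼 n) :
    mollify φ g x = ∫ t, φ.normed volume (x - t) • g t :=
  convolution_eq_swap _

theorem integrable_mollify {g : (𝔼 n) → F} (hg : LocallyIntegrable g volume) (x : 𝔼 n) :
    Integrable fun t => φ.normed volume t • g (x - t) :=
  φ.hasCompactSupport_normed.convolutionExists_left (ContinuousLinearMap.lsmul ℝ ℝ)
    φ.continuous_normed hg x

theorem contDiff_mollify [CompleteSpace F] {g : (𝔼 n) → F} (hg : LocallyIntegrable g volume) :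
    ContDiff ℝ ∞ (mollify φ g) :=
  φ.hasCompactSupport_normed.contDiff_convolution_left _ φ.contDiff_normed hg

theorem mollify_coord {g : (𝔼 n) → 𝔼 n} (hg : LocallyIntegrable g volume) (x : 𝔼 n) (i : Fin n) :
    mollify φ g x i = mollify φ (fun y => g y i) x :=
  ((EuclideanSpace.proj (𝕜 := ℝ) i).integral_comp_comm (integrable_mollify φ hg x)).symm

theorem HasWeakGradient.gradient_mollify (h : HasWeakGradient f g) :
    gradient (mollify φ f) = mollify φ g := by
  ext x i
  have hφ1 : ContDiff ℝ 1 (φ.normed volume) := φ.contDiff_normed (n := 1)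
  have hφ : ContDiff ℝ ∞ (φ.normed volume) := φ.contDiff_normed (n := ⊤)
  have hD := φ.hasCompactSupport_normed.hasFDerivAt_convolution_left
    (ContinuousLinearMap.lsmul ℝ ℝ) hφ1 h.1 x
  have hex : ConvolutionExistsAt (fderiv ℝ (φ.normed volume)) f x
      ((ContinuousLinearMap.lsmul ℝ ℝ : ℝ →L[ℝ] ℝ →L[ℝ] ℝ).precompL (𝔼 n)) volume :=
    (φ.hasCompactSupport_normed.fderiv ℝ).convolutionExists_left _
      (hφ1.continuous_fderiv (by simp)) h.1 x
  set v : 𝔼 n := EuclideanSpace.single i 1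
  have e₁ : fderiv ℝ (mollify φ f) x v =
      ∫ t, fderiv ℝ (φ.normed volume) t v * f (x - t) := by
    rw [show fderiv ℝ (mollify φ f) x = _ from hD.fderiv, convolution,
      ContinuousLinearMap.integral_apply hex]
    rfl
  have hΦ : (fun t => φ.normed volume (x - t)) ∈ testFunctions n := by
    refine ⟨hφ.comp (contDiff_const.sub contDiff_id), ?_⟩
    exact φ.hasCompactSupport_normed.comp_homeomorph (Homeomorph.subLeft x)
  have e₂ : ∀ t, fderiv ℝ (fun t => φ.normed volume (x - t)) t v =
      - fderiv ℝ (φ.normed volume) (x - t) v := by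
    intro t
    have h1 : HasFDerivAt (fun t : 𝔼 n => x - t) (-ContinuousLinearMap.id ℝ (𝔼 n)) t :=
      (hasFDerivAt_id t).const_sub x
    have h2 := ((hφ1.differentiable (by simp) (x - t)).hasFDerivAt).comp t h1
    rw [show (fun t => φ.normed volume (x - t)) = φ.normed volume ∘ fun t => x - t from rfl,
      h2.fderiv]
    simp
  rw [gradient_apply, mollify_coord φ h.2.1, mollify_apply_swap, e₁,
    ← integral_sub_left_eq_self _ volume x]
  simp only [sub_sub_cancel, smul_eq_mul]
  have := h.2.2 _ hΦ i
  simp only [e₂, mul_neg, integral_neg, neg_inj, v] at this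
  simp only [mul_comm (fderiv ℝ _ _ _), mul_comm (φ.normed volume _), v]
  exact this

end mollify

end weakGradient

theorem rpow_lintegral_le_lintegral_rpow {α : Type*} [MeasurableSpace α] (ν : Measure α)
    [IsProbabilityMeasure ν] {p : ℝ} (hp : 1 ≤ p) {F : α → ℝ≥0∞} (hF : AEMeasurable F ν) :
    (∫⁻ t, F t ∂ν) ^ p ≤ ∫⁻ t, F t ^ p ∂ν := by
  have h := eLpNorm'_le_eLpNorm'_of_exponent_le one_pos hp ν hF.aestronglyMeasurable
  simp only [eLpNorm', enorm_eq_self, ENNReal.rpow_one, div_one] at h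
  have := ENNReal.rpow_le_rpow h (zero_le_one.trans hp)
  rwa [← ENNReal.rpow_mul, one_div, inv_mul_cancel₀ (by positivity), ENNReal.rpow_one] at this

theorem lintegral_rpow_average_translate_le {n : ℕ} (ν : Measure (𝔼 n)) [IsProbabilityMeasure ν]
    (hν : ν ≪ volume) {p : ℝ} (hp : 1 ≤ p) {F : (𝔼 n) → ℝ≥0∞} (hF : AEMeasurable F volume) :
    ∫⁻ x, (∫⁻ t, F (x - t) ∂ν) ^ p ≤ ∫⁻ x, F x ^ p := by
  obtain ⟨F', hF', hFF'⟩ := hF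
  have hsub : ∀ x, ∀ᵐ t ∂ν, F (x - t) = F' (x - t) := fun x =>
    hν.ae_le ((quasiMeasurePreserving_sub_left volume x).ae hFF')
  calc ∫⁻ x, (∫⁻ t, F (x - t) ∂ν) ^ p
      = ∫⁻ x, (∫⁻ t, F' (x - t) ∂ν) ^ p := by simp only [lintegral_congr_ae (hsub _)]
    _ ≤ ∫⁻ x, ∫⁻ t, F' (x - t) ^ p ∂ν := lintegral_mono fun x =>
        rpow_lintegral_le_lintegral_rpow ν hp (by fun_prop)
    _ = ∫⁻ t, (∫⁻ x, F' (x - t) ^ p) ∂ν := by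
        refine lintegral_lintegral_swap (Measurable.aemeasurable ?_)
        exact (hF'.comp (measurable_fst.sub measurable_snd)).pow_const p
    _ = ∫⁻ t, (∫⁻ x, F' x ^ p) ∂ν := by
        exact lintegral_congr fun t => lintegral_sub_right_eq_self (fun x => F' x ^ p) t
    _ = ∫⁻ x, F x ^ p := by
        rw [lintegral_const, measure_univ, mul_one]
        refine lintegral_congr_ae ?_
        filter_upwards [hFF'] with x hx
        rw [hx]

section mollify

variable {n : ℕ} {F F' : Type*} [NormedAddCommGroup F] [NormedAddCommGroup F'] {p : ℝ}

theorem eLpNorm_le_of_enorm_le_average (φ : ContDiffBump (0 : 𝔼 n)) (hp : 1 ≤ p)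
    {g : (𝔼 n) → F} {h : (𝔼 n) → F'} (hg : AEStronglyMeasurable g volume)
    (hgh : ∀ x, ‖h x‖ₑ ≤ ∫⁻ t, ENNReal.ofReal (φ.normed volume t) * ‖g (x - t)‖ₑ) :
    eLpNorm h (ENNReal.ofReal p) volume ≤ eLpNorm g (ENNReal.ofReal p) volume := by
  set d : (𝔼 n) → ℝ≥0∞ := fun t => ENNReal.ofReal (φ.normed volume t)
  have hd : Measurable d := φ.continuous_normed.measurable.ennreal_ofReal
  set ν : Measure (𝔼 n) := volume.withDensity d
  have hν : IsProbabilityMeasure ν := by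
    constructor
    rw [withDensity_apply _ MeasurableSet.univ, Measure.restrict_univ,
      ← ofReal_integral_eq_lintegral_ofReal φ.integrable_normed
        (Eventually.of_forall φ.nonneg_normed), φ.integral_normed, ENNReal.ofReal_one]
  have hp0 : 0 < p := zero_lt_one.trans_le hp
  have hq : ENNReal.ofReal p ≠ 0 := by simpa using hp0
  rw [eLpNorm_eq_lintegral_rpow_enorm_toReal hq ENNReal.ofReal_ne_top,
    eLpNorm_eq_lintegral_rpow_enorm_toReal hq ENNReal.ofReal_ne_top, ENNReal.toReal_ofReal hp0.le]
  gcongr ?_ ^ _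
  refine le_trans (lintegral_mono fun x => ?_) (lintegral_rpow_average_translate_le ν
    (withDensity_absolutelyContinuous _ _) hp hg.enorm)
  gcongr
  refine (hgh x).trans_eq ?_
  rw [lintegral_withDensity_eq_lintegral_mul₀ hd.aemeasurable]
  · rfl
  · exact hg.enorm.comp_quasiMeasurePreserving (quasiMeasurePreserving_sub_left volume x)

variable [NormedSpace ℝ F]

theorem enorm_mollify_le (φ : ContDiffBump (0 : 𝔼 n)) (g : (𝔼 n) → F) (x : 𝔼 n) :
    ‖mollify φ g x‖ₑ ≤ ∫⁻ t, ENNReal.ofReal (φ.normed volume t) * ‖g (x - t)‖ₑ := by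
  rw [mollify_apply]
  refine (enorm_integral_le_lintegral_enorm _).trans_eq ?_
  congr 1 with t
  rw [enorm_smul, Real.enorm_of_nonneg (φ.nonneg_normed t)]

theorem eLpNorm_mollify_le (φ : ContDiffBump (0 : 𝔼 n)) (hp : 1 ≤ p)
    {g : (𝔼 n) → F} (hg : AEStronglyMeasurable g volume) :
    eLpNorm (mollify φ g) (ENNReal.ofReal p) volume ≤ eLpNorm g (ENNReal.ofReal p) volume :=
  eLpNorm_le_of_enorm_le_average φ hp hg (enorm_mollify_le φ g)

theorem mollify_sub (φ : ContDiffBump (0 : 𝔼 n)) {g₁ g₂ : (𝔼 n) → F}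
    (h₁ : LocallyIntegrable g₁ volume) (h₂ : LocallyIntegrable g₂ volume) :
    mollify φ (g₁ - g₂) = mollify φ g₁ - mollify φ g₂ := by
  ext x
  simp only [mollify_apply, Pi.sub_apply, smul_sub]
  exact integral_sub (integrable_mollify φ h₁ x) (integrable_mollify φ h₂ x)

variable [CompleteSpace F]

theorem tendsto_eLpNorm_mollify_sub_of_continuous {ι : Type*} {l : Filter ι}
    {φ : ι → ContDiffBump (0 : 𝔼 n)} (hφ : Tendsto (fun k => (φ k).rOut) l (𝓝 0))
    {c : (𝔼 n) → F} (hc : Continuous c) (hcs : HasCompactSupport c) :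
    Tendsto (fun k => eLpNorm (mollify (φ k) c - c) (ENNReal.ofReal p) volume) l (𝓝 0) := by
  set B := Metric.cthickening 1 (tsupport c)
  have hB : IsCompact B := hcs.isCompact.cthickening
  have hlim : Tendsto (fun ε : ℝ => ‖ε‖ₑ * volume B ^ (1 / (ENNReal.ofReal p).toReal)) (𝓝[>] 0)
      (𝓝 0) := by
    have : Tendsto (fun ε : ℝ => ‖ε‖ₑ * volume B ^ (1 / (ENNReal.ofReal p).toReal)) (𝓝 0)
        (𝓝 (‖(0 : ℝ)‖ₑ * volume B ^ (1 / (ENNReal.ofReal p).toReal))) := by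
      refine ENNReal.Tendsto.mul_const (continuous_enorm.tendsto 0) (Or.inr ?_)
      exact ENNReal.rpow_ne_top_of_nonneg (by positivity) hB.measure_lt_top.ne
    simp only [enorm_zero, zero_mul] at this
    exact this.mono_left nhdsWithin_le_nhds
  rw [ENNReal.tendsto_nhds_zero]
  intro η hη
  obtain ⟨ε, hε, hε0⟩ := ((hlim.eventually (Iic_mem_nhds hη)).and self_mem_nhdsWithin).exists
  obtain ⟨δ, hδ, hcδ⟩ := Metric.uniformContinuous_iff.1
    (hc.uniformContinuous_of_tendsto_cocompact hcs.is_zero_at_infty) ε hε0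
  filter_upwards [hφ.eventually (Iio_mem_nhds hδ), hφ.eventually (Iio_mem_nhds one_pos)]
    with k hk hk1
  refine le_trans (le_trans (eLpNorm_mono (g := B.indicator fun _ => ε) fun x => ?_)
    (eLpNorm_indicator_const_le ε _)) hε
  by_cases hx : x ∈ B
  · rw [indicator_of_mem hx, Pi.sub_apply, ← dist_eq_norm, Real.norm_of_nonneg (le_of_lt hε0)]
    exact ContDiffBump.dist_normed_convolution_le hc.aestronglyMeasurable
      fun y hy => (hcδ ((Metric.mem_ball.1 hy).trans hk)).le
  · have hz : ∀ y ∈ Metric.ball x (φ k).rOut, c y = 0 := by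
      intro y hy
      by_contra hne
      refine hx (Metric.mem_cthickening_of_dist_le x y 1 _ (subset_tsupport c hne) ?_)
      rw [dist_comm]
      exact ((Metric.mem_ball.1 hy).trans hk1).le
    have hx0 := hz x (Metric.mem_ball_self (φ k).rOut_pos)
    have : mollify (φ k) c x = c x :=
      ContDiffBump.normed_convolution_eq_right fun y hy => by rw [hz y hy, hx0]
    simp [this]

theorem tendsto_eLpNorm_mollify_sub {ι : Type*} {l : Filter ι}
    {φ : ι → ContDiffBump (0 : 𝔼 n)} (hφ : Tendsto (fun k => (φ k).rOut) l (𝓝 0)) (hp : 1 ≤ p)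
    {g : (𝔼 n) → F} (hg : MemLp g (ENNReal.ofReal p) volume) :
    Tendsto (fun k => eLpNorm (mollify (φ k) g - g) (ENNReal.ofReal p) volume) l (𝓝 0) := by
  have hq : 1 ≤ ENNReal.ofReal p := by simpa using hp
  rw [ENNReal.tendsto_nhds_zero]
  intro η hη
  obtain ⟨ε, hε, hεη⟩ : ∃ ε : ℝ≥0∞, 0 < ε ∧ ε + ε + ε ≤ η := by
    refine ⟨η / 3, ENNReal.div_pos hη.ne' (by simp), le_of_eq ?_⟩
    exact ENNReal.add_thirds η
  obtain ⟨c, hcs, hgc, hc, hcm⟩ :=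
    hg.exists_hasCompactSupport_eLpNorm_sub_le ENNReal.ofReal_ne_top hε.ne'
  have hgl := hg.locallyIntegrable hq
  have hcl := hc.locallyIntegrable (μ := (volume : Measure (𝔼 n)))
  filter_upwards [ENNReal.tendsto_nhds_zero.1
    (tendsto_eLpNorm_mollify_sub_of_continuous hφ hc hcs) ε hε] with k hk
  have hm : ∀ {h : (𝔼 n) → F}, LocallyIntegrable h volume →
      AEStronglyMeasurable (mollify (φ k) h) volume :=
    fun h => (contDiff_mollify (φ k) h).continuous.aestronglyMeasurable
  have hsm : AEStronglyMeasurable (g - c) volume := hg.1.sub hcm.1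
  have e : mollify (φ k) g - g = mollify (φ k) (g - c) + (mollify (φ k) c - c) - (g - c) := by
    rw [mollify_sub _ hgl hcl]
    abel
  rw [e]
  have hs : AEStronglyMeasurable (mollify (φ k) (g - c)) volume := hm (hgl.sub hcl)
  have hs' : AEStronglyMeasurable (mollify (φ k) c - c) volume := (hm hcl).sub hcm.1
  refine (eLpNorm_sub_le (hs.add hs') hsm hq).trans (le_trans ?_ hεη)
  gcongr
  refine (eLpNorm_add_le hs hs' hq).trans ?_
  gcongr
  exact (eLpNorm_mollify_le (φ k) hp hsm).trans hgc

end mollify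

/-- A `C¹` truncation with values in `[0, 1]` and slope at most `c`. -/
theorem exists_truncation {c : ℝ} (hc : 1 < c) :
    ∃ (s : ℝ) (ψ ρ : ℝ → ℝ), 0 < s ∧ s < 1 ∧ Continuous ρ ∧ (∀ t, HasDerivAt ψ (ρ t) t) ∧
      (∀ t, 0 ≤ ρ t ∧ ρ t ≤ c) ∧ (∀ t, 0 ≤ ψ t ∧ ψ t ≤ 1) ∧ (∀ t, s ≤ t → ψ t = 1) ∧
      ∀ t, |ψ t| ≤ c * |t| := by
  have hc0 : 0 < c := by linarith
  have hc1 : c⁻¹ < 1 := inv_lt_one_of_one_lt₀ hc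
  have hci : 0 < c⁻¹ := inv_pos.2 hc0
  set s : ℝ := (c⁻¹ + 1) / 2 with hs
  have hs1 : s < 1 := by linarith
  have hs0 : c⁻¹ < s := by linarith
  let b : ContDiffBump (s / 2) := ⟨c⁻¹ / 2, s / 2, by linarith, by linarith⟩
  set ρ : ℝ → ℝ := b.normed volume
  have hρ : Continuous ρ := b.continuous_normed
  have hρ0 : ∀ t, 0 ≤ ρ t := b.nonneg_normed
  have hρc : ∀ t, ρ t ≤ c := by
    intro t
    refine (b.normed_le_div_measure_closedBall_rIn volume t).trans_eq ?_
    rw [Real.volume_real_closedBall b.rIn_pos.le]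
    simp only [b]
    field_simp
  have hsupp : Function.support ρ ⊆ Ioo 0 s := by
    rw [b.support_normed_eq, Real.ball_eq_Ioo]
    simp only [b]
    intro x hx
    exact ⟨by linarith [hx.1], by linarith [hx.2]⟩
  have hd : ∀ t, HasDerivAt (fun t => ∫ u in (0 : ℝ)..t, ρ u) (ρ t) t := fun t =>
    intervalIntegral.integral_hasDerivAt_right (hρ.intervalIntegrable _ _)
      (hρ.stronglyMeasurableAtFilter _ _) hρ.continuousAt
  have hmono : Monotone fun t => ∫ u in (0 : ℝ)..t, ρ u :=
    monotone_of_deriv_nonneg (fun t => (hd t).differentiableAt) fun t => by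
      rw [(hd t).deriv]
      exact hρ0 t
  have hone : ∀ t, s ≤ t → ∫ u in (0 : ℝ)..t, ρ u = 1 := by
    intro t ht
    rw [intervalIntegral.integral_eq_integral_of_support_subset, b.integral_normed]
    exact hsupp.trans fun x hx => ⟨hx.1, hx.2.le.trans ht⟩
  have hzero : ∀ t, t ≤ 0 → ∫ u in (0 : ℝ)..t, ρ u = 0 := by
    intro t ht
    refine (intervalIntegral.integral_congr (g := fun _ => 0) fun u hu => ?_).trans (by simp)
    rw [uIcc_of_ge ht] at hu
    by_contra hne
    exact absurd (hsupp hne).1 (not_lt.2 hu.2)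
  refine ⟨s, fun t => ∫ u in (0 : ℝ)..t, ρ u, ρ, hci.trans hs0, hs1, hρ, hd,
    fun t => ⟨hρ0 t, hρc t⟩, fun t => ⟨?_, ?_⟩, hone, fun t => ?_⟩
  · exact (hzero (min t 0) (min_le_right _ _)).symm.trans_le (hmono (min_le_left _ _))
  · exact (hmono (le_max_left t s)).trans_eq (hone _ (le_max_right _ _))
  · have := intervalIntegral.norm_integral_le_of_norm_le_const (a := 0) (b := t) (f := ρ) (C := c)
      fun u _ => by rw [Real.norm_of_nonneg (hρ0 u)]; exact hρc u
    simpa using this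

theorem gradient_comp {n : ℕ} {f : (𝔼 n) → ℝ} {ψ : ℝ → ℝ} {ψ' : ℝ} {x : 𝔼 n}
    (hf : DifferentiableAt ℝ f x) (hψ : HasDerivAt ψ ψ' (f x)) :
    gradient (fun y => ψ (f y)) x = ψ' • gradient f x := by
  ext i
  have := (hψ.comp_hasFDerivAt x hf.hasFDerivAt).fderiv
  rw [PiLp.smul_apply, gradient_apply, gradient_apply]
  exact congrArg (· (EuclideanSpace.single i 1)) this

theorem tendsto_integral_mul_of_tendsto_eLpNorm {n : ℕ} {p : ℝ} (hp : 1 ≤ p)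
    {u d : ℕ → (𝔼 n) → ℝ} {Φ : (𝔼 n) → ℝ} {C : ℝ} (hu : ∀ k, Continuous (u k))
    (huC : ∀ k x, |u k x| ≤ C) (hΦ : Continuous Φ) (hΦs : HasCompactSupport Φ)
    (hd : ∀ k, AEStronglyMeasurable (d k) volume)
    (hlim : Tendsto (fun k => eLpNorm (d k) (ENNReal.ofReal p) volume) atTop (𝓝 0)) :
    Tendsto (fun k => ∫ x, u k x * d k x * Φ x) atTop (𝓝 0) := by
  set q := ENNReal.ofReal p
  have hq : 1 ≤ q := by simpa [q] using hp
  have hconj : ENNReal.HolderConjugate q q.conjExponent := ENNReal.HolderConjugate.conjExponent hq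
  have hCΦ : MemLp (fun x => C * Φ x) q.conjExponent volume :=
    (continuous_const.mul hΦ).memLp_of_hasCompactSupport hΦs.mul_left
  have hb : ∀ k, eLpNorm (fun x => u k x * d k x * Φ x) 1 volume ≤
      eLpNorm (d k) q volume * eLpNorm (fun x => C * Φ x) q.conjExponent volume := by
    intro k
    refine le_trans (eLpNorm_mono (g := d k • fun x => C * Φ x) fun x => ?_)
      (eLpNorm_smul_le_mul_eLpNorm (r := 1) hCΦ.1 (hd k))
    have hC : |u k x| ≤ |C| := (huC k x).trans (le_abs_self C)
    simp only [Pi.smul_apply', smul_eq_mul, Real.norm_eq_abs, abs_mul]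
    calc |u k x| * |d k x| * |Φ x| ≤ |C| * |d k x| * |Φ x| := by gcongr
      _ = _ := by ring
  have h0 : Tendsto (fun k => eLpNorm (fun x => u k x * d k x * Φ x) 1 volume) atTop (𝓝 0) := by
    refine tendsto_of_tendsto_of_tendsto_of_le_of_le tendsto_const_nhds ?_ (fun _ => zero_le) hb
    simpa using ENNReal.Tendsto.mul_const hlim (Or.inr hCΦ.2.ne)
  have hm : ∀ k, AEStronglyMeasurable (fun x => u k x * d k x * Φ x) volume := fun k =>
    ((hu k).aestronglyMeasurable.mul (hd k)).mul hΦ.aestronglyMeasurable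
  have := tendsto_integral_of_L1' (μ := volume) (f := fun _ : 𝔼 n => (0 : ℝ))
    (F := fun k x => u k x * d k x * Φ x) (l := atTop) aestronglyMeasurable_const ?_ ?_
  · simpa using this
  · filter_upwards [h0.eventually (Iio_mem_nhds ENNReal.zero_lt_top)] with k hk
    exact memLp_one_iff_integrable.1 ⟨hm k, hk⟩
  · refine h0.congr fun k => ?_
    congr 1
    ext x
    simp

/-- A sequence of bump functions at the origin shrinking to a point. -/
def shrinkingBump {E : Type*} [NormedAddCommGroup E] (k : ℕ) : ContDiffBump (0 : E) :=
  ⟨1 / (k + 1) / 2, 1 / (k + 1), by positivity, half_lt_self (by positivity)⟩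

theorem tendsto_rOut_shrinkingBump {E : Type*} [NormedAddCommGroup E] :
    Tendsto (fun k => (shrinkingBump (E := E) k).rOut) atTop (𝓝 0) :=
  tendsto_one_div_add_atTop_nhds_zero_nat

theorem ae_tendsto_mollify {n : ℕ} {F : Type*} [NormedAddCommGroup F] [NormedSpace ℝ F]
    [CompleteSpace F] {g : (𝔼 n) → F} (hg : LocallyIntegrable g volume) :
    ∀ᵐ x, Tendsto (fun k => mollify (shrinkingBump k) g x) atTop (𝓝 (g x)) :=
  ContDiffBump.ae_convolution_tendsto_right_of_locallyIntegrable (K := 2)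
    tendsto_rOut_shrinkingBump (Eventually.of_forall fun k => by simp [shrinkingBump]; linarith) hg

theorem HasWeakGradient.comp_of_bounded {n : ℕ} {p : ℝ} (hp : 1 ≤ p) {f : (𝔼 n) → ℝ}
    {g : (𝔼 n) → 𝔼 n} (h : HasWeakGradient f g) (hg : MemLp g (ENNReal.ofReal p) volume)
    {ψ ρ : ℝ → ℝ} {B C : ℝ} (hψ : ∀ t, HasDerivAt ψ (ρ t) t) (hρ : Continuous ρ)
    (hψB : ∀ t, |ψ t| ≤ B) (hρC : ∀ t, |ρ t| ≤ C) :
    HasWeakGradient (fun x => ψ (f x)) (fun x => ρ (f x) • g x) := by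
  have hψc : Continuous ψ := continuous_iff_continuousAt.2 fun t => (hψ t).continuousAt
  have hψ1 : ContDiff ℝ 1 ψ := by
    rw [contDiff_one_iff_deriv]
    refine ⟨fun t => (hψ t).differentiableAt, ?_⟩
    rwa [show deriv ψ = ρ from funext fun t => (hψ t).deriv]
  have hfm := h.1.aestronglyMeasurable
  have hgm := h.2.1.aestronglyMeasurable
  have hψf : AEStronglyMeasurable (fun x => ψ (f x)) volume := hψc.comp_aestronglyMeasurable hfm
  have hρf : AEStronglyMeasurable (fun x => ρ (f x)) volume := hρ.comp_aestronglyMeasurable hfm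
  refine ⟨?_, ?_, fun Φ hΦ i => ?_⟩
  · refine (locallyIntegrable_const B).mono hψf (Eventually.of_forall fun x => ?_)
    exact (hψB _).trans (le_abs_self B)
  · refine (h.2.1.smul C).mono (hρf.smul hgm) (Eventually.of_forall fun x => ?_)
    simp only [Pi.smul_apply, norm_smul, Real.norm_eq_abs]
    exact mul_le_mul_of_nonneg_right ((hρC _).trans (le_abs_self C)) (norm_nonneg _)
  set v : 𝔼 n := EuclideanSpace.single i 1
  set fk : ℕ → (𝔼 n) → ℝ := fun k => mollify (shrinkingBump k) f
  set gk : ℕ → (𝔼 n) → 𝔼 n := fun k => mollify (shrinkingBump k) g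
  have hfk : ∀ k, ContDiff ℝ ∞ (fk k) := fun k => contDiff_mollify _ h.1
  have hgk : ∀ k, Continuous (gk k) := fun k => (contDiff_mollify _ h.2.1).continuous
  have hfk1 : ∀ k, ContDiff ℝ 1 (fk k) := fun k => (hfk k).of_le (by simp)
  have hΦc : Continuous Φ := hΦ.1.continuous
  have hDΦ : Continuous fun x => fderiv ℝ Φ x v :=
    (hΦ.1.continuous_fderiv (by simp)).clm_apply continuous_const
  have hDΦs : HasCompactSupport fun x => fderiv ℝ Φ x v := hΦ.2.fderiv_apply ℝ _
  have hgi := locallyIntegrable_coord h.2.1 i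
  have hae := ae_tendsto_mollify h.1
  have e : ∀ k, ∫ x, ψ (fk k x) * fderiv ℝ Φ x v =
      - (∫ x, ρ (fk k x) * (gk k x - g x) i * Φ x) - ∫ x, ρ (fk k x) * (g x i * Φ x) := by
    intro k
    have hcont : Continuous fun x => ρ (fk k x) := hρ.comp (hfk k).continuous
    have e1 := (hasWeakGradient_gradient (hψ1.comp (hfk1 k))).2.2 Φ hΦ i
    have e2 : ∀ x, gradient (ψ ∘ fk k) x = ρ (fk k x) • gk k x := by
      intro x
      rw [show gk k = gradient (fk k) from (h.gradient_mollify _).symm]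
      exact gradient_comp ((hfk1 k).differentiable (by simp) x) (hψ _)
    simp only [e2, PiLp.smul_apply, smul_eq_mul, Function.comp_apply] at e1
    have i1 : Integrable fun x => ρ (fk k x) * (gk k x - g x) i * Φ x := by
      have : LocallyIntegrable (fun x => (gk k x - g x) i) volume :=
        locallyIntegrable_coord ((hgk k).locallyIntegrable.sub h.2.1) i
      have := this.integrable_smul_left_of_hasCompactSupport (hcont.mul hΦc) hΦ.2.mul_left
      refine this.congr (Eventually.of_forall fun x => ?_)
      simp only [smul_eq_mul, Pi.mul_apply]
      ring
    have i2 : Integrable fun x => ρ (fk k x) * (g x i * Φ x) := by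
      have := hgi.integrable_smul_left_of_hasCompactSupport (hcont.mul hΦc) hΦ.2.mul_left
      refine this.congr (Eventually.of_forall fun x => ?_)
      simp only [smul_eq_mul, Pi.mul_apply]
      ring
    rw [e1, ← neg_add', ← integral_add i1 i2]
    congr 2 with x
    simp only [PiLp.sub_apply]
    ring
  have t1 : Tendsto (fun k => ∫ x, ψ (fk k x) * fderiv ℝ Φ x v) atTop
      (𝓝 (∫ x, ψ (f x) * fderiv ℝ Φ x v)) := by
    refine tendsto_integral_of_dominated_convergence (fun x => B * |fderiv ℝ Φ x v|)
      (fun k => ((hψc.comp (hfk k).continuous).mul hDΦ).aestronglyMeasurable)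
      ((hDΦ.abs.integrable_of_hasCompactSupport (hDΦs.comp_left abs_zero)).const_mul B)
      (fun k => Eventually.of_forall fun x => ?_) ?_
    · rw [norm_mul]
      exact mul_le_mul_of_nonneg_right (hψB _) (norm_nonneg _)
    · filter_upwards [hae] with x hx
      exact ((hψc.tendsto _).comp hx).mul_const _
  have t2 : Tendsto (fun k => ∫ x, ρ (fk k x) * (g x i * Φ x)) atTop
      (𝓝 (∫ x, ρ (f x) * (g x i * Φ x))) := by
    have hint : Integrable fun x => g x i * Φ x :=
      hgi.integrable_smul_right_of_hasCompactSupport hΦc hΦ.2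
    refine tendsto_integral_of_dominated_convergence (fun x => C * |g x i * Φ x|)
      (fun k => (hρ.comp (hfk k).continuous).aestronglyMeasurable.mul hint.1)
      (hint.abs.const_mul C) (fun k => Eventually.of_forall fun x => ?_) ?_
    · rw [norm_mul]
      exact mul_le_mul_of_nonneg_right (hρC _) (norm_nonneg _)
    · filter_upwards [hae] with x hx
      exact ((hρ.tendsto _).comp hx).mul_const _
  have t3 : Tendsto (fun k => ∫ x, ρ (fk k x) * (gk k x - g x) i * Φ x) atTop (𝓝 0) := by
    refine tendsto_integral_mul_of_tendsto_eLpNorm hp (fun k => hρ.comp (hfk k).continuous)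
      (fun k x => hρC _) hΦc hΦ.2
      (fun k => (EuclideanSpace.proj (𝕜 := ℝ) i).continuous.comp_aestronglyMeasurable
        ((hgk k).aestronglyMeasurable.sub hgm)) ?_
    refine tendsto_of_tendsto_of_tendsto_of_le_of_le tendsto_const_nhds
      (tendsto_eLpNorm_mollify_sub tendsto_rOut_shrinkingBump hp hg) (fun _ => zero_le)
      fun k => eLpNorm_mono fun x => ?_
    exact PiLp.norm_apply_le _ i
  have t4 := (t3.neg.sub t2)
  simp only [← e] at t4
  rw [tendsto_nhds_unique t1 t4, neg_zero, zero_sub]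
  simp only [PiLp.smul_apply, smul_eq_mul, mul_assoc]

section supportFn

variable {m : ℕ} {Q : Set (𝔼 m)}

theorem bddAbove_inner_image (hQ : IsCompact Q) (x : 𝔼 m) :
    BddAbove ((fun y => inner ℝ x y) '' Q) :=
  (hQ.image (by fun_prop)).bddAbove

theorem inner_le_supportFn (hQ : IsCompact Q) (x : 𝔼 m) {y : 𝔼 m} (hy : y ∈ Q) :
    inner ℝ x y ≤ supportFn Q x :=
  le_csSup (bddAbove_inner_image hQ x) (mem_image_of_mem _ hy)

theorem supportFn_le (hQ0 : (0 : 𝔼 m) ∈ Q) {x : 𝔼 m} {c : ℝ} (h : ∀ y ∈ Q, inner ℝ x y ≤ c) :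
    supportFn Q x ≤ c :=
  csSup_le ⟨_, mem_image_of_mem _ hQ0⟩ (by rintro _ ⟨y, hy, rfl⟩; exact h y hy)

theorem supportFn_nonneg (hQ : IsCompact Q) (hQ0 : (0 : 𝔼 m) ∈ Q) (x : 𝔼 m) :
    0 ≤ supportFn Q x := by
  simpa using inner_le_supportFn hQ x hQ0

theorem supportFn_add_le (hQ : IsCompact Q) (hQ0 : (0 : 𝔼 m) ∈ Q) (x y : 𝔼 m) :
    supportFn Q (x + y) ≤ supportFn Q x + supportFn Q y :=
  supportFn_le hQ0 fun z hz => by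
    rw [inner_add_left]
    exact add_le_add (inner_le_supportFn hQ x hz) (inner_le_supportFn hQ y hz)

theorem supportFn_smul_le (hQ : IsCompact Q) (hQ0 : (0 : 𝔼 m) ∈ Q) {c : ℝ} (hc : 0 ≤ c)
    (x : 𝔼 m) : supportFn Q (c • x) ≤ c * supportFn Q x :=
  supportFn_le hQ0 fun z hz => by
    rw [real_inner_smul_left]
    exact mul_le_mul_of_nonneg_left (inner_le_supportFn hQ x hz) hc

theorem exists_supportFn_le_mul_norm (hQ : IsCompact Q) (hQ0 : (0 : 𝔼 m) ∈ Q) :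
    ∃ R : ℝ, 0 ≤ R ∧ ∀ x, supportFn Q x ≤ R * ‖x‖ := by
  obtain ⟨R, hR⟩ := hQ.isBounded.exists_norm_le
  refine ⟨R, (norm_nonneg _).trans (hR 0 hQ0), fun x => supportFn_le hQ0 fun y hy => ?_⟩
  rw [mul_comm]
  exact (real_inner_le_norm x y).trans (mul_le_mul_of_nonneg_left (hR y hy) (norm_nonneg _))

theorem continuous_supportFn (hQ : IsCompact Q) (hQ0 : (0 : 𝔼 m) ∈ Q) :
    Continuous (supportFn Q) := by
  obtain ⟨R, hR0, hR⟩ := exists_supportFn_le_mul_norm hQ hQ0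
  refine (LipschitzWith.of_le_add_mul R.toNNReal fun x y => ?_).continuous
  have := supportFn_add_le hQ hQ0 y (x - y)
  rw [add_sub_cancel] at this
  rw [Real.coe_toNNReal _ hR0, dist_eq_norm]
  linarith [hR (x - y)]

end supportFn

section rowMul

variable {n m : ℕ}

theorem rowMul_apply (v : 𝔼 n) (u : EuclideanSpace ℝ (Fin n × Fin m)) (j : Fin m) :
    rowMul v u j = ∑ i, v i * u (i, j) := rfl

theorem rowMul_add (v w : 𝔼 n) (u : EuclideanSpace ℝ (Fin n × Fin m)) :
    rowMul (v + w) u = rowMul v u + rowMul w u := by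
  ext j
  simp [rowMul_apply, add_mul, Finset.sum_add_distrib]

theorem rowMul_smul (c : ℝ) (v : 𝔼 n) (u : EuclideanSpace ℝ (Fin n × Fin m)) :
    rowMul (c • v) u = c • rowMul v u := by
  ext j
  simp [rowMul_apply, mul_assoc, Finset.mul_sum]

theorem norm_rowMul_le (v : 𝔼 n) (u : EuclideanSpace ℝ (Fin n × Fin m)) :
    ‖rowMul v u‖ ≤ ‖v‖ * ‖u‖ := by
  refine abs_le_of_sq_le_sq' ?_ (by positivity) |>.2
  rw [mul_pow, EuclideanSpace.real_norm_sq_eq, EuclideanSpace.real_norm_sq_eq,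
    EuclideanSpace.real_norm_sq_eq, Fintype.sum_prod_type_right, Finset.mul_sum]
  exact Finset.sum_le_sum fun j _ =>
    Finset.sum_mul_sq_le_sq_mul_sq Finset.univ (fun i => v i) fun i => u (i, j)

theorem continuous_rowMul :
    Continuous fun z : (𝔼 n) × EuclideanSpace ℝ (Fin n × Fin m) => rowMul z.1 z.2 := by
  refine (PiLp.continuous_toLp 2 _).comp (continuous_pi fun j => ?_)
  change Continuous fun z : (𝔼 n) × EuclideanSpace ℝ (Fin n × Fin m) => ∑ i, z.1 i * z.2 (i, j)
  fun_prop

end rowMul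

section directionalNorm

variable {n m : ℕ} {p : ℝ} {Q : Set (𝔼 m)}

/-- The `L_p` norm of `h_Q(Gᵀ u)` for a vector field `G`. -/
def directionalNorm (p : ℝ) (Q : Set (𝔼 m)) (G : (𝔼 n) → 𝔼 n)
    (u : EuclideanSpace ℝ (Fin n × Fin m)) : ℝ≥0∞ :=
  eLpNorm (fun x => supportFn Q (rowMul (G x) u)) (ENNReal.ofReal p) volume

theorem directionalNorm_congr {G₁ G₂ : (𝔼 n) → 𝔼 n} (h : G₁ =ᵐ[volume] G₂) :
    directionalNorm (m := m) p Q G₁ = directionalNorm p Q G₂ := by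
  ext u
  refine eLpNorm_congr_ae ?_
  filter_upwards [h] with x hx
  rw [hx]

theorem measurable_directionalNorm (hQ : IsCompact Q) (hQ0 : (0 : 𝔼 m) ∈ Q) (hp : 0 < p)
    {G : (𝔼 n) → 𝔼 n} (hG : AEStronglyMeasurable G volume) :
    Measurable (directionalNorm (m := m) p Q G) := by
  obtain ⟨G', hG', hGG'⟩ := hG
  rw [directionalNorm_congr hGG']
  have hq : ENNReal.ofReal p ≠ 0 := by simpa using hp
  have e : directionalNorm (m := m) p Q G' = fun u =>
      (∫⁻ x, ‖supportFn Q (rowMul (G' x) u)‖ₑ ^ p) ^ (1 / p) := by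
    ext u
    rw [directionalNorm, eLpNorm_eq_lintegral_rpow_enorm_toReal hq ENNReal.ofReal_ne_top,
      ENNReal.toReal_ofReal hp.le]
  rw [e]
  refine Measurable.pow_const (Measurable.lintegral_prod_right' (ν := volume)
    (f := fun z : EuclideanSpace ℝ (Fin n × Fin m) × (𝔼 n) =>
      ‖supportFn Q (rowMul (G' z.2) z.1)‖ₑ ^ p) ?_) _
  have h1 : Measurable fun z : EuclideanSpace ℝ (Fin n × Fin m) × (𝔼 n) => (G' z.2, z.1) :=
    (hG'.measurable.comp measurable_snd).prodMk measurable_fst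
  exact (((continuous_supportFn hQ hQ0).comp continuous_rowMul).measurable.comp h1).enorm.pow_const p

theorem directionalNorm_add_smul_le (hQ : IsCompact Q) (hQ0 : (0 : 𝔼 m) ∈ Q) (hp : 1 ≤ p)
    {R : ℝ} (hR : ∀ x, supportFn Q x ≤ R * ‖x‖) (hR0 : 0 ≤ R)
    {G G₁ G₂ : (𝔼 n) → 𝔼 n} (hG₁ : AEStronglyMeasurable G₁ volume)
    (hG₂ : AEStronglyMeasurable G₂ volume) {a : (𝔼 n) → ℝ} {c : ℝ}
    (ha : ∀ x, 0 ≤ a x ∧ a x ≤ c)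
    (hG : ∀ x, G x = a x • G₁ x + G₂ x) {u : EuclideanSpace ℝ (Fin n × Fin m)} (hu : ‖u‖ = 1) :
    directionalNorm p Q G u ≤ ENNReal.ofReal c * directionalNorm p Q G₁ u +
      ENNReal.ofReal R * eLpNorm G₂ (ENNReal.ofReal p) volume := by
  have hc : 0 ≤ c := (ha 0).1.trans (ha 0).2
  have hm : AEStronglyMeasurable (fun x => supportFn Q (rowMul (G₁ x) u)) volume :=
    ((continuous_supportFn hQ hQ0).comp (continuous_rowMul.comp
      (continuous_id.prodMk continuous_const))).comp_aestronglyMeasurable hG₁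
  calc directionalNorm p Q G u
      ≤ eLpNorm ((fun x => c • supportFn Q (rowMul (G₁ x) u)) + fun x => R • ‖G₂ x‖)
          (ENNReal.ofReal p) volume := by
        refine eLpNorm_mono_real fun x => ?_
        rw [Real.norm_of_nonneg (supportFn_nonneg hQ hQ0 _), hG, rowMul_add, rowMul_smul]
        refine (supportFn_add_le hQ hQ0 _ _).trans (add_le_add ?_ ?_)
        · refine (supportFn_smul_le hQ hQ0 (ha x).1 _).trans ?_
          exact mul_le_mul_of_nonneg_right (ha x).2 (supportFn_nonneg hQ hQ0 _)
        · refine (hR _).trans (mul_le_mul_of_nonneg_left ?_ hR0)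
          simpa [hu] using norm_rowMul_le (G₂ x) u
    _ ≤ _ := eLpNorm_add_le (hm.const_smul c) (hG₂.norm.const_smul R) (by simpa using hp)
    _ = _ := by
        have h1 := eLpNorm_const_smul (μ := volume) (p := ENNReal.ofReal p) c
          fun x => supportFn Q (rowMul (G₁ x) u)
        have h2 := eLpNorm_const_smul (μ := volume) (p := ENNReal.ofReal p) R fun x => ‖G₂ x‖
        rw [Real.enorm_of_nonneg hc] at h1
        rw [Real.enorm_of_nonneg hR0, eLpNorm_norm] at h2
        exact congrArg₂ (· + ·) h1 h2

theorem supportFn_rowMul_mollify_le (hQ : IsCompact Q) (hQ0 : (0 : 𝔼 m) ∈ Q)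
    (φ : ContDiffBump (0 : 𝔼 n)) {G : (𝔼 n) → 𝔼 n} (hG : LocallyIntegrable G volume)
    (u : EuclideanSpace ℝ (Fin n × Fin m)) (x : 𝔼 n) :
    supportFn Q (rowMul (mollify φ G x) u) ≤
      mollify φ (fun y => supportFn Q (rowMul (G y) u)) x := by
  obtain ⟨R, hR0, hR⟩ := exists_supportFn_le_mul_norm hQ hQ0
  have hloc : LocallyIntegrable (fun y => supportFn Q (rowMul (G y) u)) volume := by
    refine (hG.smul (R * ‖u‖)).mono (((continuous_supportFn hQ hQ0).comp (continuous_rowMul.comp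
      (continuous_id.prodMk continuous_const))).comp_aestronglyMeasurable hG.aestronglyMeasurable)
      (Eventually.of_forall fun y => ?_)
    rw [Real.norm_of_nonneg (supportFn_nonneg hQ hQ0 _), Pi.smul_apply, norm_smul,
      Real.norm_of_nonneg (by positivity), mul_assoc, mul_comm ‖u‖]
    exact (hR _).trans (mul_le_mul_of_nonneg_left (norm_rowMul_le _ _) hR0)
  refine supportFn_le hQ0 fun y hy => ?_
  let ℓ : (𝔼 n) →ₗ[ℝ] ℝ :=
    { toFun := fun v => inner ℝ (rowMul v u) y
      map_add' := fun v w => by rw [rowMul_add, inner_add_left]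
      map_smul' := fun c v => by rw [rowMul_smul, real_inner_smul_left]; rfl }
  have hint := integrable_mollify φ hG x
  calc inner ℝ (rowMul (mollify φ G x) u) y
      = ∫ t, ℓ.toContinuousLinearMap (φ.normed volume t • G (x - t)) :=
        (ℓ.toContinuousLinearMap.integral_comp_comm hint).symm
    _ ≤ ∫ t, φ.normed volume t • supportFn Q (rowMul (G (x - t)) u) := by
        refine integral_mono (ℓ.toContinuousLinearMap.integrable_comp hint)
          (integrable_mollify φ hloc x) fun t => ?_
        simp only [map_smul]
        exact mul_le_mul_of_nonneg_left (inner_le_supportFn hQ _ hy) (φ.nonneg_normed t)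

theorem directionalNorm_mollify_le (hQ : IsCompact Q) (hQ0 : (0 : 𝔼 m) ∈ Q) (hp : 1 ≤ p)
    (φ : ContDiffBump (0 : 𝔼 n)) {G : (𝔼 n) → 𝔼 n} (hG : LocallyIntegrable G volume)
    (u : EuclideanSpace ℝ (Fin n × Fin m)) :
    directionalNorm p Q (mollify φ G) u ≤ directionalNorm p Q G u := by
  refine eLpNorm_le_of_enorm_le_average φ hp (((continuous_supportFn hQ hQ0).comp
    (continuous_rowMul.comp (continuous_id.prodMk continuous_const))).comp_aestronglyMeasurable
    hG.aestronglyMeasurable) 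
    fun x => le_trans ?_ (enorm_mollify_le φ (fun y => supportFn Q (rowMul (G y) u)) x)
  refine enorm_le_iff_norm_le.2 ?_
  rw [Real.norm_of_nonneg (supportFn_nonneg hQ hQ0 _)]
  exact (supportFn_rowMul_mollify_le hQ hQ0 φ hG u x).trans (le_abs_self _)

end directionalNorm

theorem rpow_neg_le_rpow_neg {x y : ℝ≥0∞} {s : ℝ} (hs : 0 ≤ s) (h : x ≤ y) :
    y ^ (-s) ≤ x ^ (-s) := by
  rw [ENNReal.rpow_neg, ENNReal.rpow_neg, ENNReal.inv_le_inv]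
  exact ENNReal.rpow_le_rpow h hs

theorem le_lintegral_rpow_neg_of_tendsto {α : Type*} [MeasurableSpace α] {μ : Measure α}
    {a : α → ℝ≥0∞} {b : ℕ → α → ℝ≥0∞} {r s : ℝ} (hs : 0 < s)
    (hb : ∀ k, Measurable (b k)) (hlim : ∀ x, Tendsto (fun k => b k x) atTop (𝓝 (a x)))
    {I : ℝ≥0∞} (hI : ∀ k, I ≤ (∫⁻ x, b k x ^ (-r) ∂μ) ^ (-s)) :
    I ≤ (∫⁻ x, a x ^ (-r) ∂μ) ^ (-s) := by
  have key : ∀ X : ℝ≥0∞, I ≤ X ^ (-s) ↔ X ≤ I⁻¹ ^ s⁻¹ := fun X => by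
    rw [ENNReal.rpow_neg, ENNReal.le_inv_iff_le_inv, ENNReal.le_rpow_inv_iff hs]
  rw [key]
  have hlim' : ∀ x, liminf (fun k => b k x ^ (-r)) atTop = a x ^ (-r) := fun x =>
    (((ENNReal.continuous_rpow_const (y := -r)).tendsto _).comp (hlim x)).liminf_eq
  calc ∫⁻ x, a x ^ (-r) ∂μ = ∫⁻ x, liminf (fun k => b k x ^ (-r)) atTop ∂μ := by
        simp only [hlim']
    _ ≤ liminf (fun k => ∫⁻ x, b k x ^ (-r) ∂μ) atTop :=
        lintegral_liminf_le fun k => (hb k).pow_const _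
    _ ≤ I⁻¹ ^ s⁻¹ := by
        refine (liminf_le_liminf (v := fun _ => I⁻¹ ^ s⁻¹)
          (Eventually.of_forall fun k => (key _).1 (hI k))).trans ?_
        simp

theorem le_energy_of_forall_le {n m : ℕ} (hn : 0 < n) (hm : 0 < m) {p : ℝ} (hp : 0 < p)
    {Q : Set (𝔼 m)} (hQ : IsCompact Q) (hQ0 : (0 : 𝔼 m) ∈ Q)
    {f : (𝔼 n) → ℝ} (hf : AEStronglyMeasurable (weakGrad f) volume) {S : Set ((𝔼 n) → ℝ)}
    (h : ∀ c : ℝ, 1 < c → ∀ δ : ℝ≥0∞, 0 < δ → ∃ φ ∈ S,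
      ∀ u : EuclideanSpace ℝ (Fin n × Fin m), ‖u‖ = 1 → directionalNorm p Q (weakGrad φ) u ≤
        ENNReal.ofReal c * (directionalNorm p Q (weakGrad f) u + δ)) :
    ⨅ φ ∈ S, energy p Q φ ≤ energy p Q f := by
  have hr : (0 : ℝ) < n * m := by positivity
  have hc : Tendsto (fun k : ℕ => (1 : ℝ) + 1 / ((k : ℝ) + 1)) atTop (𝓝 1) := by
    simpa using tendsto_one_div_add_atTop_nhds_zero_nat.const_add (1 : ℝ)
  have hd : Tendsto (fun k : ℕ => ENNReal.ofReal (1 / ((k : ℝ) + 1))) atTop (𝓝 0) := by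
    simpa using ENNReal.tendsto_ofReal (tendsto_one_div_add_atTop_nhds_zero_nat (𝕜 := ℝ))
  have hmeas := (measurable_directionalNorm (m := m) hQ hQ0 hp hf).comp
    (measurable_subtype_coe (p := (· ∈ Metric.sphere (0 : EuclideanSpace ℝ (Fin n × Fin m)) 1)))
  refine le_lintegral_rpow_neg_of_tendsto (b := fun k (u : Metric.sphere (0 : EuclideanSpace ℝ (Fin n × Fin m)) 1) =>
      ENNReal.ofReal (1 + 1 / ((k : ℝ) + 1)) * (directionalNorm p Q (weakGrad f) u +
        ENNReal.ofReal (1 / ((k : ℝ) + 1)))) (div_pos hp hr)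
    (fun k => (hmeas.add_const _).const_mul _) (fun u => ?_) fun k => ?_
  · have := ENNReal.Tendsto.mul (ENNReal.tendsto_ofReal hc) (by simp)
      (hd.const_add (directionalNorm p Q (weakGrad f) u)) (by simp)
    simpa [directionalNorm] using this
  · obtain ⟨φ, hφ, hle⟩ := h (1 + 1 / ((k : ℝ) + 1)) (by simp; positivity)
      (ENNReal.ofReal (1 / ((k : ℝ) + 1))) (by simp; positivity)
    refine (iInf₂_le φ hφ).trans ?_
    refine rpow_neg_le_rpow_neg (by positivity) (lintegral_mono fun u => ?_)
    exact rpow_neg_le_rpow_neg hr.le (hle u (by simp))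

section capacity

variable {n m : ℕ} {p : ℝ}

theorem hasCompactSupport_gradient {f : (𝔼 n) → ℝ} (hf : HasCompactSupport f) :
    HasCompactSupport (gradient f) :=
  (hf.fderiv ℝ).comp_left (map_zero _)

theorem gradient_mul {χ k : (𝔼 n) → ℝ} {x : 𝔼 n} (hχ : DifferentiableAt ℝ χ x)
    (hk : DifferentiableAt ℝ k x) :
    gradient (fun y => χ y * k y) x = χ x • gradient k x + k x • gradient χ x := by
  ext i
  rw [PiLp.add_apply, PiLp.smul_apply, PiLp.smul_apply, gradient_apply, gradient_apply,
    gradient_apply, fderiv_fun_mul hχ hk]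
  simp

theorem MemW.memLp_weakGrad {f : (𝔼 n) → ℝ} (hf : MemW p f) :
    MemLp (weakGrad f) (ENNReal.ofReal p) volume := by
  obtain ⟨-, g, hg, hgp⟩ := hf
  exact hgp.ae_eq hg.weakGrad_ae_eq.symm

theorem MemW.hasWeakGradient_weakGrad {f : (𝔼 n) → ℝ} (hf : MemW p f) :
    HasWeakGradient f (weakGrad f) := by
  obtain ⟨-, g, hg, -⟩ := hf
  exact hg.weakGrad

theorem memW_of_mem_testFunctions {φ : (𝔼 n) → ℝ} (hφ : φ ∈ testFunctions n) : MemW p φ := by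
  have h1 : ContDiff ℝ 1 φ := hφ.1.of_le (by simp)
  exact ⟨hφ.1.continuous.memLp_of_hasCompactSupport hφ.2, _, hasWeakGradient_gradient h1,
    (continuous_gradient h1).memLp_of_hasCompactSupport (hasCompactSupport_gradient hφ.2)⟩

theorem weakGrad_zero_ae_eq : weakGrad (0 : (𝔼 n) → ℝ) =ᵐ[volume] 0 := by
  have h : HasWeakGradient (0 : (𝔼 n) → ℝ) (gradient 0) :=
    hasWeakGradient_gradient contDiff_const
  refine h.weakGrad_ae_eq.trans (Eventually.of_forall fun x => ?_)
  ext i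
  simp [gradient_apply]

theorem zero_mem_testFunctions : (0 : (𝔼 n) → ℝ) ∈ testFunctions n :=
  ⟨contDiff_const, HasCompactSupport.zero⟩

theorem sobolevCapacity_empty (hp : 0 < p) : sobolevCapacity p (∅ : Set (𝔼 n)) = 0 := by
  refine le_antisymm (sInf_le ⟨0, memW_of_mem_testFunctions zero_mem_testFunctions,
    ⟨∅, isOpen_empty, Subset.rfl, by simp⟩, ?_⟩) zero_le
  rw [eLpNorm_congr_ae weakGrad_zero_ae_eq]
  simp [hp]

theorem testFunctions_subset_W0 (hp : 0 < p) : testFunctions n ⊆ W0 n p := by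
  intro φ hφ
  refine ⟨⟨memW_of_mem_testFunctions hφ, fun ε hε => ⟨φ, hφ, ?_⟩⟩, fun ε hε =>
    ⟨∅, isOpen_empty, ?_, hφ.1.continuous.continuousOn⟩⟩
  · rw [sub_self, sobolevNorm, eLpNorm_congr_ae weakGrad_zero_ae_eq]
    simpa using hε
  · rwa [sobolevCapacity_empty hp]

theorem classA_subset_classB (K : Set (𝔼 n)) : classA p K ⊆ classB p K := fun f hf =>
  ⟨hf.1, fun x hx => by simpa [hx] using hf.2 x⟩

theorem classD_subset_classA (K : Set (𝔼 n)) : classD p K ⊆ classA p K := by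
  rintro f ⟨hf, hf01, U, -, hKU, hU⟩
  refine ⟨hf, fun x => ?_⟩
  by_cases hx : x ∈ K
  · simp [hx, hU x (hKU hx)]
  · simpa [hx] using (hf01 x).1

theorem MemLp.of_abs_le_mul {f h : (𝔼 n) → ℝ} {q : ℝ≥0∞} {c : ℝ} (hf : MemLp f q volume)
    (hh : AEStronglyMeasurable h volume) (hle : ∀ x, |h x| ≤ c * |f x|) : MemLp h q volume :=
  hf.of_le_mul hh (Eventually.of_forall hle)

/-- A function in `ℬ(K)` can be truncated to a Sobolev function with values in `[0, 1]` that is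
equal to `1` almost everywhere near `K`, at an arbitrarily small cost in the directional norms. -/
theorem exists_truncated (hp : 1 ≤ p) {Q : Set (𝔼 m)} (hQ : IsCompact Q)
    (hQ0 : (0 : 𝔼 m) ∈ Q) {K : Set (𝔼 n)} {f : (𝔼 n) → ℝ} (hf : f ∈ classB p K) {c : ℝ}
    (hc : 1 < c) {δ : ℝ≥0∞} (hδ : 0 < δ) :
    ∃ (h : (𝔼 n) → ℝ) (H : (𝔼 n) → 𝔼 n), HasWeakGradient h H ∧
      MemLp h (ENNReal.ofReal p) volume ∧ (∀ x, 0 ≤ h x ∧ h x ≤ 1) ∧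
      (∃ V, IsOpen V ∧ K ⊆ V ∧ ∀ᵐ x ∂volume, x ∈ V → h x = 1) ∧
      ∀ u : EuclideanSpace ℝ (Fin n × Fin m), ‖u‖ = 1 → directionalNorm p Q H u ≤
        ENNReal.ofReal (c ^ 2) * (directionalNorm p Q (weakGrad f) u + δ) := by
  obtain ⟨⟨⟨hfW, -⟩, hfq⟩, hfK⟩ := hf
  have hp0 : 0 < p := zero_lt_one.trans_le hp
  obtain ⟨R, hR0, hR⟩ := exists_supportFn_le_mul_norm hQ hQ0
  obtain ⟨s, ψ, ρ, hs0, hs1, hρ, hψ, hρc, hψ01, hψs, hψc⟩ := exists_truncation hc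
  have hc0 : 0 < c := by linarith
  have hψcont : Continuous ψ := continuous_iff_continuousAt.2 fun t => (hψ t).continuousAt
  have hψB : ∀ t, |ψ t| ≤ 1 := fun t => by rw [abs_of_nonneg (hψ01 t).1]; exact (hψ01 t).2
  have hρC : ∀ t, |ρ t| ≤ c := fun t => by rw [abs_of_nonneg (hρc t).1]; exact (hρc t).2
  set η : ℝ≥0∞ := δ / (ENNReal.ofReal R + 1)
  have hη : 0 < η := ENNReal.div_pos hδ.ne' (by simp)
  obtain ⟨G, hG, hGη, hfG⟩ := hfq (η ^ p) (ENNReal.rpow_pos_of_nonneg hη hp0.le)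
  obtain ⟨_, ⟨w, hw, ⟨U, hU, hGU, hwU⟩, rfl⟩, hwη⟩ := sInf_lt_iff.1 hGη
  have hwη' : ENNReal.ofReal R * eLpNorm (weakGrad w) (ENNReal.ofReal p) volume ≤ δ := by
    have h1 : eLpNorm (weakGrad w) (ENNReal.ofReal p) volume ≤ η :=
      (ENNReal.rpow_le_rpow_iff hp0).1 (le_add_self.trans hwη.le)
    calc _ ≤ (ENNReal.ofReal R + 1) * η := by gcongr; exact le_self_add
      _ ≤ δ := ENNReal.mul_div_le
  have hfg := hfW.hasWeakGradient_weakGrad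
  have hwg := hw.hasWeakGradient_weakGrad
  have hfL := hfW.memLp_weakGrad
  have hwL := hw.memLp_weakGrad
  have h₁ := hfg.comp_of_bounded hp hfL hψ hρ hψB hρC
  have h₂ := hwg.comp_of_bounded hp hwL hψ hρ hψB hρC
  have trunc : ∀ {v : (𝔼 n) → ℝ}, MemLp v (ENNReal.ofReal p) volume →
      MemLp (fun x => ψ (v x)) (ENNReal.ofReal p) volume := fun hv =>
    MemLp.of_abs_le_mul hv (hψcont.comp_aestronglyMeasurable hv.1) fun x => hψc _
  have truncG : ∀ {v : (𝔼 n) → ℝ} {g : (𝔼 n) → 𝔼 n}, AEStronglyMeasurable v volume →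
      MemLp g (ENNReal.ofReal p) volume →
      MemLp (fun x => ρ (v x) • g x) (ENNReal.ofReal p) volume := fun hv hg =>
    hg.of_le_mul (c := c) ((hρ.comp_aestronglyMeasurable hv).smul hg.1)
      (Eventually.of_forall fun x => by
        rw [norm_smul]
        exact mul_le_mul_of_nonneg_right (hρC _) (norm_nonneg _))
  have hsum := h₁.add h₂
  have hsumL := (truncG hfW.1.1 hfL).add (truncG hw.1.1 hwL)
  have h₃ := hsum.comp_of_bounded hp hsumL hψ hρ hψB hρC
  refine ⟨_, _, h₃, trunc ((trunc hfW.1).add (trunc hw.1)), fun x => hψ01 _, ?_, fun u hu => ?_⟩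
  · obtain ⟨O, hO, hOG⟩ := continuousOn_iff'.1 hfG (Ioi s) isOpen_Ioi
    refine ⟨U ∪ O, hU.union hO, fun x hx => ?_, ?_⟩
    · by_cases hxG : x ∈ G
      · exact Or.inl (hGU hxG)
      · have : x ∈ f ⁻¹' Ioi s ∩ Gᶜ := ⟨hs1.trans_le (hfK x hx), hxG⟩
        rw [hOG] at this
        exact Or.inr this.1
    · filter_upwards [hwU] with x hxw hx
      refine hψs _ ?_
      simp only [Pi.add_apply]
      by_cases hxU : x ∈ U
      · rw [hψs (w x) (hs1.le.trans (hxw hxU))]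
        linarith [(hψ01 (f x)).1]
      · have hxO : x ∈ O ∩ Gᶜ := ⟨hx.resolve_left hxU, fun h => hxU (hGU h)⟩
        rw [← hOG] at hxO
        rw [hψs (f x) (le_of_lt hxO.1)]
        linarith [(hψ01 (w x)).1]
  · set S : (𝔼 n) → ℝ := (fun x => ψ (f x)) + fun x => ψ (w x)
    have hcc : ∀ x y, 0 ≤ ρ x * ρ y ∧ ρ x * ρ y ≤ c ^ 2 := fun x y =>
      ⟨mul_nonneg (hρc x).1 (hρc y).1, by
        rw [sq]; exact mul_le_mul (hρc x).2 (hρc y).2 (hρc y).1 hc0.le⟩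
    have hSm : AEStronglyMeasurable S volume := hsum.1.aestronglyMeasurable
    have hG₂ : AEStronglyMeasurable (fun x => (ρ (S x) * ρ (w x)) • weakGrad w x) volume :=
      ((hρ.comp_aestronglyMeasurable hSm).mul (hρ.comp_aestronglyMeasurable hw.1.1)).smul hwL.1
    have hle := directionalNorm_add_smul_le hQ hQ0 hp hR hR0 hfL.1 hG₂
      (G := fun x => ρ (S x) • (((fun x => ρ (f x) • weakGrad f x) +
        fun x => ρ (w x) • weakGrad w x) x)) (a := fun x => ρ (S x) * ρ (f x))
      (fun x => hcc _ _) (fun x => by simp only [Pi.add_apply, smul_add, smul_smul]) hu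
    refine hle.trans ?_
    rw [mul_add]
    refine add_le_add le_rfl ?_
    calc _ ≤ ENNReal.ofReal R *
          (ENNReal.ofReal (c ^ 2) * eLpNorm (weakGrad w) (ENNReal.ofReal p) volume) := by
          gcongr
          refine eLpNorm_le_mul_eLpNorm_of_ae_le_mul (Eventually.of_forall fun x => ?_) _
          rw [norm_smul, Real.norm_of_nonneg (hcc _ _).1]
          exact mul_le_mul_of_nonneg_right (hcc _ _).2 (norm_nonneg _)
      _ = ENNReal.ofReal (c ^ 2) *
          (ENNReal.ofReal R * eLpNorm (weakGrad w) (ENNReal.ofReal p) volume) := by ring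
      _ ≤ _ := by gcongr

theorem mollify_mem_Icc (φ : ContDiffBump (0 : 𝔼 n)) {h : (𝔼 n) → ℝ}
    (hh : LocallyIntegrable h volume) (h01 : ∀ x, 0 ≤ h x ∧ h x ≤ 1) (x : 𝔼 n) :
    0 ≤ mollify φ h x ∧ mollify φ h x ≤ 1 := by
  refine ⟨integral_nonneg fun t => mul_nonneg (φ.nonneg_normed t) (h01 _).1, ?_⟩
  rw [mollify_apply, ← φ.integral_normed (μ := volume)]
  exact integral_mono (integrable_mollify φ hh x) φ.integrable_normed fun t =>
    mul_le_of_le_one_right (φ.nonneg_normed t) (h01 _).2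

theorem mollify_eq_one (φ : ContDiffBump (0 : 𝔼 n)) {h : (𝔼 n) → ℝ} {V : Set (𝔼 n)}
    (hV : ∀ᵐ x ∂volume, x ∈ V → h x = 1) {x : 𝔼 n} (hx : Metric.ball x φ.rOut ⊆ V) :
    mollify φ h x = 1 := by
  rw [mollify_apply_swap, ← integral_sub_left_eq_self _ volume x]
  simp only [sub_sub_cancel]
  rw [← φ.integral_normed (μ := volume)]
  refine integral_congr_ae ?_
  filter_upwards [(quasiMeasurePreserving_sub_left volume x).ae hV] with t ht
  by_cases htz : t ∈ Function.support (φ.normed volume)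
  · rw [φ.support_normed_eq] at htz
    rw [ht (hx _), smul_eq_mul, mul_one]
    simpa [dist_eq_norm] using htz
  · rw [Function.notMem_support.1 htz, zero_smul]

/-- A smooth cutoff function with small gradient. -/
theorem exists_cutoff (n : ℕ) : ∃ M : ℝ, 0 ≤ M ∧ ∀ t : ℝ, 0 < t → ∃ χ : (𝔼 n) → ℝ,
    ContDiff ℝ ∞ χ ∧ HasCompactSupport χ ∧ (∀ x, 0 ≤ χ x ∧ χ x ≤ 1) ∧
    (∀ x, t * ‖x‖ ≤ 1 → χ x = 1) ∧ ∀ x, ‖gradient χ x‖ ≤ M * t := by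
  let b : ContDiffBump (0 : 𝔼 n) := ⟨1, 2, one_pos, one_lt_two⟩
  have hb1 : ContDiff ℝ 1 b := b.contDiff
  obtain ⟨M, hM⟩ := (hb1.continuous_fderiv (by simp)).bounded_above_of_compact_support
    (b.hasCompactSupport.fderiv ℝ)
  refine ⟨M, (norm_nonneg _).trans (hM 0), fun t ht => ⟨fun x => b (t • x), ?_, ?_,
    fun x => ⟨b.nonneg, b.le_one⟩, fun x hx => b.one_of_mem_closedBall ?_, fun x => ?_⟩⟩
  · exact b.contDiff.comp (contDiff_const_smul t)
  · exact b.hasCompactSupport.comp_smul ht.ne'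
  · simpa [norm_smul, abs_of_pos ht] using hx
  · have h1 : HasFDerivAt (fun x : 𝔼 n => t • x) (t • ContinuousLinearMap.id ℝ (𝔼 n)) x :=
      (hasFDerivAt_id x).const_smul t
    have h2 := ((hb1.differentiable (by simp) (t • x)).hasFDerivAt.comp x h1).fderiv
    rw [gradient, LinearIsometryEquiv.norm_map]
    rw [show (fun x => b (t • x)) = b ∘ fun x => t • x from rfl, h2,
      ContinuousLinearMap.comp_smul, ContinuousLinearMap.comp_id, norm_smul,
      Real.norm_of_nonneg ht.le, mul_comm]
    exact mul_le_mul_of_nonneg_right (hM _) ht.le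

theorem exists_testFunction (hp : 1 ≤ p) {Q : Set (𝔼 m)} (hQ : IsCompact Q)
    (hQ0 : (0 : 𝔼 m) ∈ Q) {K : Set (𝔼 n)} (hK : IsCompact K) {h : (𝔼 n) → ℝ}
    {H : (𝔼 n) → 𝔼 n} (hH : HasWeakGradient h H) (hhp : MemLp h (ENNReal.ofReal p) volume)
    (h01 : ∀ x, 0 ≤ h x ∧ h x ≤ 1) {V : Set (𝔼 n)} (hV : IsOpen V) (hKV : K ⊆ V)
    (hhV : ∀ᵐ x ∂volume, x ∈ V → h x = 1) {δ : ℝ≥0∞} (hδ : 0 < δ) :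
    ∃ φ ∈ testFunctions n ∩ classD p K, ∀ u : EuclideanSpace ℝ (Fin n × Fin m), ‖u‖ = 1 →
      directionalNorm p Q (weakGrad φ) u ≤ directionalNorm p Q H u + δ := by
  obtain ⟨R, hR0, hR⟩ := exists_supportFn_le_mul_norm hQ hQ0
  obtain ⟨r, hr0, hr⟩ := hK.exists_thickening_subset_open hV hKV
  let η : ContDiffBump (0 : 𝔼 n) := ⟨r / 2 / 2, r / 2, by positivity, half_lt_self (by positivity)⟩
  set k := mollify η h
  have hk : ContDiff ℝ ∞ k := contDiff_mollify η hH.1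
  have hk01 := mollify_mem_Icc η hH.1 h01
  have hkone : ∀ x ∈ Metric.thickening (r / 2) K, k x = 1 := by
    intro x hx
    refine mollify_eq_one η hhV fun y hy => hr ?_
    obtain ⟨z, hz, hxz⟩ := Metric.mem_thickening_iff.1 hx
    refine Metric.mem_thickening_iff.2 ⟨z, hz, ?_⟩
    have hy' : dist y x < r / 2 := hy
    linarith [dist_triangle y x z]
  have hkp : eLpNorm k (ENNReal.ofReal p) volume ≤ eLpNorm h (ENNReal.ofReal p) volume :=
    eLpNorm_mollify_le η hp hhp.1
  have hkg : gradient k = mollify η H := hH.gradient_mollify η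
  obtain ⟨M, hM0, hM⟩ := exists_cutoff n
  obtain ⟨ρ, hρ0, hρ⟩ := hK.isBounded.subset_ball_lt 0 0
  have hlim : Tendsto (fun t : ℝ => ENNReal.ofReal R *
      (ENNReal.ofReal (M * t) * eLpNorm h (ENNReal.ofReal p) volume)) (𝓝[>] 0) (𝓝 0) := by
    have h1 : Tendsto (fun t : ℝ => ENNReal.ofReal (M * t)) (𝓝[>] 0) (𝓝 0) := by
      have : Tendsto (fun t : ℝ => ENNReal.ofReal (M * t)) (𝓝 0) (𝓝 (ENNReal.ofReal (M * 0))) :=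
        ENNReal.tendsto_ofReal (tendsto_id.const_mul M)
      simp only [mul_zero, ENNReal.ofReal_zero] at this
      exact this.mono_left nhdsWithin_le_nhds
    simpa using ENNReal.Tendsto.const_mul
      (ENNReal.Tendsto.mul_const h1 (Or.inr hhp.2.ne)) (Or.inr ENNReal.ofReal_ne_top)
  have hsmall : ∀ᶠ t : ℝ in 𝓝[>] 0, t < ρ⁻¹ :=
    nhdsWithin_le_nhds (Iio_mem_nhds (inv_pos.2 hρ0))
  obtain ⟨t, ⟨htδ, htρ⟩, ht0⟩ :=
    (((ENNReal.tendsto_nhds_zero.1 hlim δ hδ).and hsmall).and self_mem_nhdsWithin).exists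
  obtain ⟨χ, hχ, hχs, hχ01, hχ1, hχM⟩ := hM t ht0
  set φ : (𝔼 n) → ℝ := fun x => χ x * k x
  have hφt : φ ∈ testFunctions n := ⟨hχ.mul hk, hχs.mul_right⟩
  have hφ1 : ContDiff ℝ 1 φ := hφt.1.of_le (by simp)
  have hχ₁ : ContDiff ℝ 1 χ := hχ.of_le (by simp)
  have hk₁ : ContDiff ℝ 1 k := hk.of_le (by simp)
  refine ⟨φ, ⟨hφt, testFunctions_subset_W0 (zero_lt_one.trans_le hp) hφt, fun x => ⟨?_, ?_⟩,
    Metric.thickening (r / 2) K ∩ Metric.ball 0 ρ, Metric.isOpen_thickening.inter Metric.isOpen_ball,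
    subset_inter (Metric.self_subset_thickening (by positivity) K) hρ, fun x hx => ?_⟩,
    fun u hu => ?_⟩
  · exact mul_nonneg (hχ01 x).1 (hk01 x).1
  · exact mul_le_one₀ (hχ01 x).2 (hk01 x).1 (hk01 x).2
  · have hx2 : ‖x‖ < ρ := by simpa using hx.2
    have : χ x = 1 := by
      refine hχ1 x ?_
      calc t * ‖x‖ ≤ ρ⁻¹ * ρ := by gcongr
        _ = 1 := inv_mul_cancel₀ hρ0.ne'
    simp only [φ, this, hkone x hx.1, mul_one]
  · rw [directionalNorm_congr (hasWeakGradient_gradient hφ1).weakGrad_ae_eq]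
    have hle := directionalNorm_add_smul_le hQ hQ0 hp hR hR0
      (continuous_gradient hk₁).aestronglyMeasurable
      (hk.continuous.smul (continuous_gradient hχ₁)).aestronglyMeasurable hχ01
      (fun x => gradient_mul (hχ₁.differentiable (by simp) x) (hk₁.differentiable (by simp) x)) hu
    refine hle.trans ?_
    rw [ENNReal.ofReal_one, one_mul, hkg]
    refine add_le_add (directionalNorm_mollify_le hQ hQ0 hp η hH.2.1 u) (le_trans ?_ htδ)
    gcongr
    refine le_trans (eLpNorm_le_mul_eLpNorm_of_ae_le_mul (g := k) (c := M * t)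
      (Eventually.of_forall fun x => ?_) _) (by gcongr)
    rw [Pi.smul_apply', norm_smul, mul_comm]
    exact mul_le_mul_of_nonneg_right (hχM x) (norm_nonneg _)

theorem iInf_testFunctions_inter_classD_le_energy (hn : 0 < n) (hm : 0 < m) (hp : 1 ≤ p)
    {Q : Set (𝔼 m)} (hQ : IsCompact Q) (hQ0 : (0 : 𝔼 m) ∈ Q) {K : Set (𝔼 n)} (hK : IsCompact K)
    {f : (𝔼 n) → ℝ} (hf : f ∈ classB p K) :
    ⨅ φ ∈ testFunctions n ∩ classD p K, energy p Q φ ≤ energy p Q f := by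
  refine le_energy_of_forall_le hn hm (zero_lt_one.trans_le hp) hQ hQ0
    hf.1.1.1.memLp_weakGrad.1 fun c hc δ hδ => ?_
  have hδ2 : 0 < δ / 2 := ENNReal.half_pos hδ.ne'
  have hsq : 1 < √c := by rwa [Real.lt_sqrt zero_le_one, one_pow]
  obtain ⟨h, H, hH, hhp, h01, ⟨V, hV, hKV, hhV⟩, hle⟩ := exists_truncated hp hQ hQ0 hf hsq hδ2
  rw [Real.sq_sqrt (by linarith)] at hle
  obtain ⟨φ, hφ, hφle⟩ := exists_testFunction hp hQ hQ0 hK hH hhp h01 hV hKV hhV hδ2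
  refine ⟨φ, hφ, fun u hu => (hφle u hu).trans ?_⟩
  calc directionalNorm p Q H u + δ / 2
      ≤ ENNReal.ofReal c * (directionalNorm p Q (weakGrad f) u + δ / 2) +
          ENNReal.ofReal c * (δ / 2) := by
        refine add_le_add (hle u hu) (le_mul_of_one_le_left' ?_)
        rw [← ENNReal.ofReal_one]
        exact ENNReal.ofReal_le_ofReal hc.le
    _ = ENNReal.ofReal c * (directionalNorm p Q (weakGrad f) u + δ) := by
        rw [← mul_add, add_assoc, ENNReal.add_halves]

end capacity

end AffineCapacity

end

theorem theorem3p2 (n m : ℕ) (hm : 0 < m) (p : ℝ) (hp : 1 ≤ p) (hpn : p < n)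
    (Q : Set (EuclideanSpace ℝ (Fin m))) (hQcompact : IsCompact Q) (hQconvex : Convex ℝ Q)
    (hQinterior : (interior Q).Nonempty) (hQzero : (0 : EuclideanSpace ℝ (Fin m)) ∈ Q)
    (K : Set (EuclideanSpace ℝ (Fin n))) (hK : IsCompact K) :
    AffineCapacity.capacity p Q K =
      (⨅ f ∈ AffineCapacity.classB p K, AffineCapacity.energy p Q f) ∧
    AffineCapacity.capacity p Q K =
      (⨅ f ∈ AffineCapacity.classD p K, AffineCapacity.energy p Q f) ∧
    AffineCapacity.capacity p Q K =
      (⨅ f ∈ AffineCapacity.testFunctions n ∩ AffineCapacity.classA p K, AffineCapacity.energy p Q f) ∧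
    AffineCapacity.capacity p Q K =
      (⨅ f ∈ AffineCapacity.testFunctions n ∩ AffineCapacity.classB p K, AffineCapacity.energy p Q f) ∧
    AffineCapacity.capacity p Q K =
      (⨅ f ∈ AffineCapacity.testFunctions n ∩ AffineCapacity.classD p K, AffineCapacity.energy p Q f) := by
  have hn : 0 < n := by
    have : (0 : ℝ) < n := by linarith
    exact_mod_cast this
  have hAB := AffineCapacity.classA_subset_classB (p := p) K
  have hDA := AffineCapacity.classD_subset_classA (p := p) K
  have key : (⨅ f ∈ AffineCapacity.testFunctions n ∩ AffineCapacity.classD p K,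
      AffineCapacity.energy p Q f) ≤
      ⨅ f ∈ AffineCapacity.classB p K, AffineCapacity.energy p Q f :=
    le_iInf₂ fun f hf => AffineCapacity.iInf_testFunctions_inter_classD_le_energy hn hm hp
      hQcompact hQzero hK hf
  have mono : ∀ S T : Set (EuclideanSpace ℝ (Fin n) → ℝ), S ⊆ T →
      (⨅ f ∈ T, AffineCapacity.energy p Q f) ≤ ⨅ f ∈ S, AffineCapacity.energy p Q f :=
    fun S T h => biInf_mono h
  have squeeze : ∀ S : Set (EuclideanSpace ℝ (Fin n) → ℝ),
      AffineCapacity.testFunctions n ∩ AffineCapacity.classD p K ⊆ S →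
      S ⊆ AffineCapacity.classB p K → (⨅ f ∈ S, AffineCapacity.energy p Q f) =
        ⨅ f ∈ AffineCapacity.classB p K, AffineCapacity.energy p Q f :=
    fun S h₁ h₂ => le_antisymm ((mono _ _ h₁).trans key) (mono _ _ h₂)
  have hcap : AffineCapacity.capacity p Q K =
      ⨅ f ∈ AffineCapacity.classB p K, AffineCapacity.energy p Q f :=
    squeeze _ (inter_subset_right.trans hDA) hAB
  rw [hcap]
  exact ⟨rfl, (squeeze _ inter_subset_right (hDA.trans hAB)).symm,
    (squeeze _ (inter_subset_inter_right _ hDA) (inter_subset_right.trans hAB)).symm,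
    (squeeze _ (inter_subset_inter_right _ (hDA.trans hAB)) inter_subset_right).symm,
    (squeeze _ Subset.rfl (inter_subset_right.trans (hDA.trans hAB))).symm⟩
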